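/- For $a,b>0$ and $x\in[0,1]$ let \[ I(x;a,b)=\frac{\int_0^x t^{a-1}(1-t)^{b-1}\,dt}{B(a,b)},\qquad B(a,b)=\frac{\Gamma(a)\Gamma(b)}{\Gamma(a+b)}, \] be the regularised incomplete beta function. Fix $p\in(0,1)$ and $b>0$. For every $a>0$ there is a unique $q(a)\in(0,1)$ with $I(q(a);a,b)=p$ (the inverse incomplete beta function $q(a)=I_p^{-1}(a,b)$), and the function $q:(0,\infty)\to(0,1)$ is strictly log-concave: $\log q$ is strictly concave on $(0,\infty)$; equivalently, $\psi=-\log q$ is strictly convex on $(0,\infty)$. -/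

import Mathlib

open Set

noncomputable section

/-- The regularised incomplete beta function
`I(x; a, b) = (∫₀ˣ t ^ (a - 1) (1 - t) ^ (b - 1) dt) / B(a, b)`,
where `B(a, b) = Γ(a) Γ(b) / Γ(a + b)`; meant for `0 ≤ x ≤ 1` and `0 < a`, `0 < b`. -/
def regIncBeta (x a b : ℝ) : ℝ :=
  (∫ t in (0 : ℝ)..x, t ^ (a - 1) * (1 - t) ^ (b - 1)) / ProbabilityTheory.beta a b

/-- The inverse incomplete beta function `I_p⁻¹(a, b)`: the point `x` of `(0, 1)` with
`I(x; a, b) = p`, that is, the `p`-quantile of the beta distribution. -/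
def invIncBeta (p a b : ℝ) : ℝ :=
  Function.invFunOn (fun x => regIncBeta x a b) (Ioo 0 1) p

/-- A function is strictly log-concave on `s` if it is positive on `s` and its logarithm is
strictly concave on `s`. -/
def StrictLogConcaveOn (s : Set ℝ) (f : ℝ → ℝ) : Prop :=
  (∀ x ∈ s, 0 < f x) ∧ StrictConcaveOn ℝ s (fun x => Real.log (f x))

end

/-! Fix `b` and let `w a x = x ^ (a - 1) (1 - x) ^ (b - 1)` on `(0, 1)` be the beta weight. Write
`q a` for the inverse incomplete beta function. Formally, `(log q)' = J (a, q a)`, where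
`J (a, t) = Cov (log X, 1_{X > t}) / (t f(t))` for `X` beta distributed with density `f`; so strict
concavity of `log q` follows once `J` is positive, strictly decreasing in `t` and decreasing in `a`.
Both monotonicities come from the representation `J (a, t) = E_a [H (X, t)]`
(`logSpread_eq`, `covariance_eq`), in which `H = covKernel b` does not involve `a`.

To obtain it, write the covariance as the double integral of
`(log σ - log τ) w(τ) w(σ)` over `τ < t < σ`. Since `w(τ) w(σ)` depends on `a` only through the
product `σ τ`, substitute `σ = s t / τ` and integrate over `τ` first. With
`θ = (1 - τ) (1 - σ) / ((1 - s) (1 - t))` as the new variable the weights become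
`w(s) w(t) θ ^ (b - 1)`, and what is left of the integrand is the reciprocal
`(log σ - log τ) / (σ - τ) = ∫₀^∞ dz / ((z + σ) (z + τ))` of the logarithmic mean. The numbers
`σ`, `τ` have product `s t` and a sum which is affine in `θ`, so
`(z + σ) (z + τ) / ((1 - s) (1 - t)) = (z + s) / (1 - s) * ((z + t) / (1 - t)) + (1 - θ) z`.
This is increasing in `s` and in `t`. Hence `H` is symmetric and strictly decreasing in each
variable (`covKernel_lt_covKernel`), so `J` is strictly decreasing in `t`; it is decreasing in `a`
by Chebyshev's correlation inequality, as raising `a` multiplies the density by a power of `x`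
(`integral_mul_le_of_antitoneOn`).

The differentiability of `q` is not needed. Along the curve `u x = q(a₀) exp (s (x - a₀))` with
`s = J (a₀, q(a₀))`, the derivative of `x ↦ I(u x; x, b)` has the sign of `s - J (x, u x)`, which is
that of `x - a₀`. So `I(u x; x, b) > p` for `x ≠ a₀`, that is, `q x < u x`: the line
`log q(a₀) + s (x - a₀)` lies strictly above `log q` (`log_invIncBeta_lt`). -/

open MeasureTheory Filter Topology

/-! ### The beta weight -/

/-- The unnormalised density `x ^ (a - 1) (1 - x) ^ (b - 1)` of the beta distribution. -/
noncomputable def betaWeight (a b x : ℝ) : ℝ := x ^ (a - 1) * (1 - x) ^ (b - 1)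

lemma betaWeight_pos {a b x : ℝ} (hx : x ∈ Ioo (0 : ℝ) 1) : 0 < betaWeight a b x :=
  mul_pos (Real.rpow_pos_of_pos hx.1 _) (Real.rpow_pos_of_pos (by linarith [hx.2]) _)

@[fun_prop]
lemma measurable_betaWeight (a b : ℝ) : Measurable (betaWeight a b) := by
  unfold betaWeight; fun_prop

lemma integrableOn_betaWeight {a b : ℝ} (ha : 0 < a) (hb : 0 < b) :
    IntegrableOn (betaWeight a b) (Ioo 0 1) := by
  have h := Complex.betaIntegral_convergent (u := a) (v := b) (by simpa) (by simpa)
  rw [intervalIntegrable_iff_integrableOn_Ioo_of_le zero_le_one] at h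
  refine IntegrableOn.congr_fun h.re (fun x hx => ?_) measurableSet_Ioo
  simp only [betaWeight]
  norm_cast
  rw [← Complex.ofReal_cpow hx.1.le, ← Complex.ofReal_cpow (by linarith [hx.2])]
  norm_cast

lemma integral_betaWeight {a b : ℝ} (ha : 0 < a) (hb : 0 < b) :
    ∫ x in Ioo 0 1, betaWeight a b x = ProbabilityTheory.beta a b := by
  have h := Complex.betaIntegral_convergent (u := a) (v := b) (by simpa) (by simpa)
  rw [intervalIntegrable_iff_integrableOn_Ioo_of_le zero_le_one] at h
  rw [ProbabilityTheory.beta_eq_betaIntegralReal a b ha hb, Complex.betaIntegral,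
    intervalIntegral.integral_of_le zero_le_one, integral_Ioc_eq_integral_Ioo,
    ← RCLike.re_to_complex, ← integral_re h]
  refine setIntegral_congr_fun measurableSet_Ioo (fun x hx => ?_)
  simp only [betaWeight]
  norm_cast
  rw [← Complex.ofReal_cpow hx.1.le, ← Complex.ofReal_cpow (by linarith [hx.2])]
  norm_cast

/-- The logarithmic singularity at `0` costs an arbitrarily small power of `x`. -/
lemma abs_log_mul_betaWeight_le {a c b x : ℝ} (hca : c < a)
    (hx : x ∈ Ioo (0 : ℝ) 1) :
    |Real.log x * betaWeight a b x| ≤ 1 / (a - c) * betaWeight c b x := by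
  have h1 := (Real.abs_log_mul_self_rpow_lt x (a - c) hx.1 hx.2.le (by linarith)).le
  have h2 : Real.log x * betaWeight a b x = (Real.log x * x ^ (a - c)) * betaWeight c b x := by
    unfold betaWeight
    rw [show a - 1 = (a - c) + (c - 1) by ring, Real.rpow_add hx.1]; ring
  rw [h2, abs_mul, abs_of_pos (betaWeight_pos (a := c) hx)]
  exact mul_le_mul_of_nonneg_right h1 (betaWeight_pos hx).le

lemma integrableOn_log_mul_betaWeight {a b : ℝ} (ha : 0 < a) (hb : 0 < b) :
    IntegrableOn (fun x => Real.log x * betaWeight a b x) (Ioo 0 1) := by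
  refine Integrable.mono' ((integrableOn_betaWeight (a := a / 2) (by positivity) hb).const_mul
    (1 / (a - a / 2))) (by fun_prop) ?_
  refine ae_restrict_of_forall_mem measurableSet_Ioo fun x hx => ?_
  exact abs_log_mul_betaWeight_le (by linarith) hx

/-- The weight decreases in `a`, for `x` in the unit interval. -/
lemma betaWeight_le_betaWeight {a c b x : ℝ} (hca : c ≤ a) (hx : x ∈ Ioo (0 : ℝ) 1) :
    betaWeight a b x ≤ betaWeight c b x := by
  unfold betaWeight
  have : (0 : ℝ) ≤ (1 - x) ^ (b - 1) := Real.rpow_nonneg (by linarith [hx.2]) _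
  gcongr ?_ * _
  exact Real.rpow_le_rpow_of_exponent_ge hx.1 hx.2.le (by linarith)

lemma hasDerivAt_betaWeight {a b x : ℝ} (hx : 0 < x) :
    HasDerivAt (fun a => betaWeight a b x) (Real.log x * betaWeight a b x) a := by
  unfold betaWeight
  have h := ((((hasDerivAt_id a).sub_const 1).const_rpow hx).mul_const ((1 - x) ^ (b - 1)))
  refine h.congr_deriv ?_
  simp; ring

/-- Differentiation of the incomplete beta integral in the parameter `a`. -/
lemma hasDerivAt_setIntegral_betaWeight {a b : ℝ} (ha : 0 < a) (hb : 0 < b) {S : Set ℝ}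
    (hS : S ⊆ Ioo 0 1) (hSm : MeasurableSet S) :
    HasDerivAt (fun a => ∫ x in S, betaWeight a b x)
      (∫ x in S, Real.log x * betaWeight a b x) a := by
  refine (hasDerivAt_integral_of_dominated_loc_of_deriv_le
    (F := fun a x => betaWeight a b x) (F' := fun a x => Real.log x * betaWeight a b x)
    (bound := fun x => 1 / (a / 2 - a / 4) * betaWeight (a / 4) b x)
    (s := Ioi (a / 2)) (Ioi_mem_nhds (by linarith)) ?_ ?_ ?_ ?_ ?_ ?_).2
  · exact Eventually.of_forall fun _ => (measurable_betaWeight _ _).aestronglyMeasurable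
  · exact (integrableOn_betaWeight ha hb).mono_set hS
  · exact Measurable.aestronglyMeasurable (by fun_prop)
  · refine ae_restrict_of_forall_mem hSm fun x hx c hc => ?_
    have hx := hS hx
    have hc' : a / 2 < c := hc
    refine le_trans ?_ (abs_log_mul_betaWeight_le (by linarith) hx)
    rw [Real.norm_eq_abs, abs_mul, abs_mul, abs_of_pos (betaWeight_pos hx),
      abs_of_pos (betaWeight_pos hx)]
    exact mul_le_mul_of_nonneg_left (betaWeight_le_betaWeight hc'.le hx) (abs_nonneg _)
  · exact ((integrableOn_betaWeight (by positivity) hb).mono_set hS).const_mul _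
  · exact ae_restrict_of_forall_mem hSm fun x hx c _ => hasDerivAt_betaWeight (hS hx).1

/-! ### The regularised incomplete beta function and its inverse -/

lemma intervalIntegrable_betaWeight {a b x y : ℝ} (ha : 0 < a) (hb : 0 < b)
    (hx : x ∈ Icc (0 : ℝ) 1) (hy : y ∈ Icc (0 : ℝ) 1) :
    IntervalIntegrable (betaWeight a b) volume x y := by
  have : IntervalIntegrable (betaWeight a b) volume 0 1 := by
    rw [intervalIntegrable_iff_integrableOn_Ioo_of_le zero_le_one]
    exact integrableOn_betaWeight ha hb
  refine this.mono_set ?_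
  rw [uIcc_of_le zero_le_one]
  exact (convex_Icc (0 : ℝ) 1).ordConnected.uIcc_subset hx hy

lemma regIncBeta_eq {a b x : ℝ} (hx : 0 ≤ x) :
    regIncBeta x a b = (∫ t in Ioo 0 x, betaWeight a b t) / ProbabilityTheory.beta a b := by
  rw [regIncBeta, intervalIntegral.integral_of_le hx, integral_Ioc_eq_integral_Ioo]
  rfl

lemma regIncBeta_sub {a b x y : ℝ} (ha : 0 < a) (hb : 0 < b)
    (hx : x ∈ Icc (0 : ℝ) 1) (hy : y ∈ Icc (0 : ℝ) 1) :
    regIncBeta y a b - regIncBeta x a b =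
      (∫ t in x..y, betaWeight a b t) / ProbabilityTheory.beta a b := by
  have h0 : (0 : ℝ) ∈ Icc (0 : ℝ) 1 := ⟨le_rfl, zero_le_one⟩
  have := intervalIntegral.integral_interval_sub_left
    (intervalIntegrable_betaWeight ha hb h0 hy) (intervalIntegrable_betaWeight ha hb h0 hx)
  rw [← this, sub_div]
  rfl

lemma strictMonoOn_regIncBeta {a b : ℝ} (ha : 0 < a) (hb : 0 < b) :
    StrictMonoOn (fun x => regIncBeta x a b) (Icc 0 1) := by
  intro x hx y hy hxy
  have h := regIncBeta_sub ha hb hx hy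
  have : 0 < ∫ t in x..y, betaWeight a b t :=
    intervalIntegral.intervalIntegral_pos_of_pos_on (intervalIntegrable_betaWeight ha hb hx hy)
      (fun t ht => betaWeight_pos ⟨hx.1.trans_lt ht.1, ht.2.trans_le hy.2⟩) hxy
  have := div_pos this (ProbabilityTheory.beta_pos ha hb)
  simp only
  linarith

lemma continuousOn_regIncBeta {a b : ℝ} (ha : 0 < a) (hb : 0 < b) :
    ContinuousOn (fun x => regIncBeta x a b) (Icc 0 1) := by
  have h : IntegrableOn (betaWeight a b) (uIcc 0 1) := by
    rw [uIcc_of_le zero_le_one, integrableOn_Icc_iff_integrableOn_Ioo]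
    exact integrableOn_betaWeight ha hb
  have := intervalIntegral.continuousOn_primitive_interval h
  rw [uIcc_of_le zero_le_one] at this
  exact this.div_const _

lemma regIncBeta_zero (a b : ℝ) : regIncBeta 0 a b = 0 := by simp [regIncBeta]

lemma regIncBeta_one {a b : ℝ} (ha : 0 < a) (hb : 0 < b) : regIncBeta 1 a b = 1 := by
  rw [regIncBeta_eq zero_le_one, integral_betaWeight ha hb,
    div_self (ProbabilityTheory.beta_pos ha hb).ne']

lemma exists_regIncBeta_eq {a b p : ℝ} (ha : 0 < a) (hb : 0 < b) (hp : p ∈ Ioo (0 : ℝ) 1) :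
    ∃ x ∈ Ioo (0 : ℝ) 1, regIncBeta x a b = p := by
  have h := intermediate_value_Ioo zero_le_one (continuousOn_regIncBeta ha hb)
  simp only [regIncBeta_zero, regIncBeta_one ha hb] at h
  exact h hp

lemma invIncBeta_mem {a b p : ℝ} (ha : 0 < a) (hb : 0 < b) (hp : p ∈ Ioo (0 : ℝ) 1) :
    invIncBeta p a b ∈ Ioo (0 : ℝ) 1 :=
  Function.invFunOn_mem (exists_regIncBeta_eq ha hb hp)

lemma regIncBeta_invIncBeta {a b p : ℝ} (ha : 0 < a) (hb : 0 < b) (hp : p ∈ Ioo (0 : ℝ) 1) :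
    regIncBeta (invIncBeta p a b) a b = p :=
  Function.invFunOn_eq (f := fun x => regIncBeta x a b) (exists_regIncBeta_eq ha hb hp)

/-! ### The covariance kernel -/

/-- The reciprocal of the logarithmic mean of `σ` and `τ` as an integral. -/
lemma lintegral_inv_mul_eq_log {σ τ : ℝ} (hτ : 0 < τ) (hστ : τ < σ) :
    ∫⁻ z in Ioi (0 : ℝ), ENNReal.ofReal ((z + σ) * (z + τ))⁻¹ =
      ENNReal.ofReal ((Real.log σ - Real.log τ) / (σ - τ)) := by
  have hd : 0 < σ - τ := by linarith
  have hderiv : ∀ z ∈ Ici (0 : ℝ), HasDerivAt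
      (fun z => (Real.log (z + τ) - Real.log (z + σ)) / (σ - τ)) ((z + σ) * (z + τ))⁻¹ z := by
    intro z hz
    have hz : 0 ≤ z := hz
    have h1 : z + τ ≠ 0 := by positivity
    have h2 : z + σ ≠ 0 := by linarith
    refine ((((hasDerivAt_id z).add_const τ).log h1).sub
      (((hasDerivAt_id z).add_const σ).log h2)).div_const (σ - τ) |>.congr_deriv ?_
    simp only [id]
    field_simp
    ring
  have hpos : ∀ z ∈ Ioi (0 : ℝ), 0 ≤ ((z + σ) * (z + τ))⁻¹ := by
    intro z hz
    have hz : 0 < z := hz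
    have : 0 < z + σ := by linarith
    positivity
  have hlim : Tendsto (fun z => (Real.log (z + τ) - Real.log (z + σ)) / (σ - τ)) atTop (𝓝 0) := by
    have h1 : Tendsto (fun z => (z + τ) / (z + σ)) atTop (𝓝 1) := by
      have : Tendsto (fun z => 1 - (σ - τ) / (z + σ)) atTop (𝓝 (1 - 0)) :=
        tendsto_const_nhds.sub
          ((tendsto_atTop_add_const_right _ σ tendsto_id).const_div_atTop (σ - τ))
      rw [sub_zero] at this
      refine this.congr' ?_
      filter_upwards [eventually_gt_atTop 0] with z hz
      have : z + σ ≠ 0 := by linarith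
      field_simp
      ring
    have h2 := (h1.log one_ne_zero).div_const (σ - τ)
    rw [Real.log_one, zero_div] at h2
    refine h2.congr' ?_
    filter_upwards [eventually_gt_atTop 0] with z hz
    rw [Real.log_div (by linarith) (by linarith)]
  rw [← ofReal_integral_eq_lintegral_ofReal
    (integrableOn_Ioi_deriv_of_nonneg' hderiv hpos hlim)
    (ae_restrict_of_forall_mem measurableSet_Ioi hpos),
    integral_Ioi_of_hasDerivAt_of_nonneg' hderiv hpos hlim]
  congr 1
  simp only [zero_add]
  ring

/-- The kernel `H (s, t)` that represents the covariance of `log X` and `1_{X > t}` as an average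
over `s`. The inner integral is the reciprocal of the logarithmic mean of the `σ > τ` with
`σ τ = s t` and `(1 - σ) (1 - τ) = θ (1 - s) (1 - t)`, times `(1 - s) (1 - t)`; this form makes the
monotonicity in `s` and `t` visible. -/
noncomputable def covKernel (b s t : ℝ) : ENNReal :=
  ∫⁻ θ in Ioo (0 : ℝ) 1, ENNReal.ofReal (θ ^ (b - 1)) *
    ∫⁻ z in Ioi (0 : ℝ),
      ENNReal.ofReal ((z + s) / (1 - s) * ((z + t) / (1 - t)) + (1 - θ) * z)⁻¹

/-- The ratio of `(1 - τ) (1 - σ)` to `(1 - s) (1 - t)`, where `σ = s t / τ`. It is the change of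
variables that turns the weights of `τ` and `σ` into those of `s` and `t`. -/
noncomputable def chordRatio (s t τ : ℝ) : ℝ :=
  (1 - τ) * (1 - s * t / τ) / ((1 - s) * (1 - t))

lemma hasDerivAt_chordRatio {s t τ : ℝ} (hτ : τ ≠ 0) :
    HasDerivAt (chordRatio s t) ((s * t / τ - τ) / (τ * ((1 - s) * (1 - t)))) τ := by
  have h := (((hasDerivAt_id τ).const_sub 1).mul
    (((hasDerivAt_const τ (s * t)).div (hasDerivAt_id τ) hτ).const_sub 1)).div_const
      ((1 - s) * (1 - t))
  refine h.congr_deriv ?_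
  rw [div_mul_eq_div_div (s * t / τ - τ) τ]
  congr 1
  simp only [id, Pi.div_apply]
  field_simp
  ring

lemma lt_div_of_mem {s t τ : ℝ} (hs : s ∈ Ioo (0 : ℝ) 1) (ht : t ∈ Ioo (0 : ℝ) 1)
    (hτ : τ ∈ Ioo (s * t) (min s t)) : 0 < τ ∧ τ < s * t / τ := by
  have h0 : 0 < τ := (mul_pos hs.1 ht.1).trans hτ.1
  obtain ⟨h1, h2⟩ := lt_min_iff.1 hτ.2
  exact ⟨h0, (lt_div_iff₀ h0).2 (mul_lt_mul h1 h2.le h0 hs.1.le)⟩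

lemma strictMonoOn_chordRatio {s t : ℝ} (hs : s ∈ Ioo (0 : ℝ) 1) (ht : t ∈ Ioo (0 : ℝ) 1) :
    StrictMonoOn (chordRatio s t) (Icc (s * t) (min s t)) := by
  have hst := mul_pos hs.1 ht.1
  refine strictMonoOn_of_deriv_pos (convex_Icc _ _) (fun τ hτ => ?_) (fun τ hτ => ?_)
  · exact (hasDerivAt_chordRatio (hst.trans_le hτ.1).ne').continuousAt.continuousWithinAt
  · rw [interior_Icc] at hτ
    obtain ⟨h0, h1⟩ := lt_div_of_mem hs ht hτ
    rw [(hasDerivAt_chordRatio h0.ne').deriv]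
    have h2 := sub_pos.2 hs.2
    have h3 := sub_pos.2 ht.2
    have := sub_pos.2 h1
    positivity

lemma image_chordRatio {s t : ℝ} (hs : s ∈ Ioo (0 : ℝ) 1) (ht : t ∈ Ioo (0 : ℝ) 1) :
    chordRatio s t '' Ioo (s * t) (min s t) = Ioo 0 1 := by
  have hst := mul_pos hs.1 ht.1
  have hle : s * t ≤ min s t :=
    le_min (mul_le_of_le_one_right hs.1.le ht.2.le) (mul_le_of_le_one_left ht.1.le hs.2.le)
  have hl : chordRatio s t (s * t) = 0 := by
    simp [chordRatio, div_self hst.ne']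
  have hr : chordRatio s t (min s t) = 1 := by
    have h2 := (sub_pos.2 hs.2).ne'
    have h3 := (sub_pos.2 ht.2).ne'
    have := hs.1.ne'
    have := ht.1.ne'
    unfold chordRatio
    rcases min_choice s t with h | h <;> rw [h] <;> field_simp
  have hmono := strictMonoOn_chordRatio hs ht
  apply Subset.antisymm
  · rintro _ ⟨τ, hτ, rfl⟩
    have h1 := hmono (left_mem_Icc.2 hle) (Ioo_subset_Icc_self hτ) hτ.1
    have h2 := hmono (Ioo_subset_Icc_self hτ) (right_mem_Icc.2 hle) hτ.2
    rw [hl] at h1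
    rw [hr] at h2
    exact ⟨h1, h2⟩
  · have := intermediate_value_Ioo hle (f := chordRatio s t) (fun τ hτ =>
      (hasDerivAt_chordRatio (hst.trans_le hτ.1).ne').continuousAt.continuousWithinAt)
    rwa [hl, hr] at this

/-- The kernel in the variable `τ`, before the substitution `θ = chordRatio s t τ`. -/
lemma covKernel_eq {b s t : ℝ} (hs : s ∈ Ioo (0 : ℝ) 1) (ht : t ∈ Ioo (0 : ℝ) 1) :
    covKernel b s t = ∫⁻ τ in Ioo (s * t) (min s t),
      ENNReal.ofReal ((Real.log (s * t / τ) - Real.log τ) / τ * chordRatio s t τ ^ (b - 1)) := by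
  have h2 := sub_pos.2 hs.2
  have h3 := sub_pos.2 ht.2
  rw [covKernel, ← image_chordRatio hs ht,
    lintegral_image_eq_lintegral_deriv_mul_of_monotoneOn measurableSet_Ioo
      (fun τ hτ => (hasDerivAt_chordRatio (lt_div_of_mem hs ht hτ).1.ne').hasDerivWithinAt)
      ((strictMonoOn_chordRatio hs ht).monotoneOn.mono Ioo_subset_Icc_self)]
  refine setLIntegral_congr_fun measurableSet_Ioo fun τ hτ => ?_
  obtain ⟨h0, h1⟩ := lt_div_of_mem hs ht hτ
  have hθ : 0 ≤ chordRatio s t τ := by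
    have : chordRatio s t τ ∈ Ioo (0 : ℝ) 1 := image_chordRatio hs ht ▸ mem_image_of_mem _ hτ
    exact this.1.le
  have hinner : ∀ z ∈ Ioi (0 : ℝ), ENNReal.ofReal
      ((z + s) / (1 - s) * ((z + t) / (1 - t)) + (1 - chordRatio s t τ) * z)⁻¹ =
      ENNReal.ofReal ((1 - s) * (1 - t)) * ENNReal.ofReal ((z + s * t / τ) * (z + τ))⁻¹ := by
    intro z _
    rw [← ENNReal.ofReal_mul (by positivity)]
    congr 1
    -- `(z + σ) (z + τ) = (z + 1) (z + s t) - (1 - σ) (1 - τ) z` as `σ τ = s t`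
    have : (z + s) / (1 - s) * ((z + t) / (1 - t)) + (1 - chordRatio s t τ) * z =
        (z + s * t / τ) * (z + τ) / ((1 - s) * (1 - t)) := by
      unfold chordRatio
      field_simp
      ring
    rw [this, inv_div, div_eq_mul_inv]
  rw [setLIntegral_congr_fun measurableSet_Ioi hinner, lintegral_const_mul _ (by fun_prop),
    lintegral_inv_mul_eq_log h0 h1]
  have hd := sub_pos.2 h1
  rw [← ENNReal.ofReal_mul (by positivity), ← ENNReal.ofReal_mul (by positivity),
    ← ENNReal.ofReal_mul (by positivity)]
  congr 1
  generalize chordRatio s t τ ^ (b - 1) = r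
  generalize Real.log (s * t / τ) - Real.log τ = l
  generalize s * t / τ = σ at *
  have := hd.ne'
  field_simp

/-- The integral of `(log σ - log τ) w(τ) w(σ)` over `0 < τ < t < σ < 1`: up to the square of the
beta function, the covariance of `log X` and `1_{X > t}`. -/
noncomputable def logSpread (a b t : ℝ) : ENNReal :=
  ∫⁻ τ in Ioo 0 t, ∫⁻ σ in Ioo t 1,
    ENNReal.ofReal ((Real.log σ - Real.log τ) * (betaWeight a b τ * betaWeight a b σ))

/-- The substitution `σ = s t / τ` for fixed `τ`. -/
lemma setLIntegral_scale {t τ : ℝ} (ht : 0 < t) (hτ : 0 < τ) (f : ℝ → ENNReal) :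
    ∫⁻ σ in Ioo t 1, f σ =
      ∫⁻ s in Ioo τ (τ / t), ENNReal.ofReal (t / τ) * f (s * t / τ) := by
  have himg : (fun s => s * t / τ) '' Ioo τ (τ / t) = Ioo t 1 := by
    have h := image_mul_right_Ioo τ (τ / t) (c := t / τ) (by positivity)
    have e : (fun s : ℝ => s * t / τ) = fun s => s * (t / τ) := by
      funext s; ring
    rw [e, h]
    congr 1 <;> field_simp
  rw [← himg, lintegral_image_eq_lintegral_deriv_mul_of_monotoneOn (f' := fun _ => t / τ)
    measurableSet_Ioo]
  · intro s _
    have := ((hasDerivAt_id s).mul_const t).div_const τ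
    simpa using this.hasDerivWithinAt
  · intro x _ y _ hxy
    simp only
    gcongr

/-- Tonelli on the region `0 < τ < t`, `s t < τ < s`. -/
lemma lintegral_region_swap {t : ℝ} (ht : t ∈ Ioo (0 : ℝ) 1) {g : ℝ → ℝ → ENNReal}
    (hg : Measurable (Function.uncurry g)) :
    ∫⁻ τ in Ioo 0 t, ∫⁻ s in Ioo τ (τ / t), g τ s =
      ∫⁻ s in Ioo 0 1, ∫⁻ τ in Ioo (s * t) (min s t), g τ s := by
  let S : Set (ℝ × ℝ) := {p | 0 < p.1 ∧ p.1 < t ∧ p.1 < p.2 ∧ p.2 * t < p.1}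
  have hS : MeasurableSet S := by
    exact ((isOpen_lt continuous_const continuous_fst).inter
      ((isOpen_lt continuous_fst continuous_const).inter
      ((isOpen_lt continuous_fst continuous_snd).inter
      (isOpen_lt (continuous_snd.mul continuous_const) continuous_fst)))).measurableSet
  have h1 : ∀ τ s, (Ioo 0 t).indicator (fun τ => (Ioo τ (τ / t)).indicator (g τ) s) τ =
      S.indicator (Function.uncurry g) (τ, s) := by
    intro τ s
    by_cases hτ : τ ∈ Ioo 0 t
    · rw [indicator_of_mem hτ]
      by_cases hs : s ∈ Ioo τ (τ / t)
      · rw [indicator_of_mem hs, indicator_of_mem]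
        · rfl
        · exact ⟨hτ.1, hτ.2, hs.1, (lt_div_iff₀ ht.1).1 hs.2⟩
      · rw [indicator_of_notMem hs, indicator_of_notMem]
        exact fun h => hs ⟨h.2.2.1, (lt_div_iff₀ ht.1).2 h.2.2.2⟩
    · rw [indicator_of_notMem hτ, indicator_of_notMem]
      exact fun h => hτ ⟨h.1, h.2.1⟩
  have h2 : ∀ s τ, (Ioo 0 1).indicator
      (fun s => (Ioo (s * t) (min s t)).indicator (fun τ => g τ s) τ) s =
      S.indicator (Function.uncurry g) (τ, s) := by
    intro s τ
    by_cases hs : s ∈ Ioo (0 : ℝ) 1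
    · rw [indicator_of_mem hs]
      by_cases hτ : τ ∈ Ioo (s * t) (min s t)
      · rw [indicator_of_mem hτ, indicator_of_mem]
        · rfl
        · exact ⟨(mul_pos hs.1 ht.1).trans hτ.1, (lt_min_iff.1 hτ.2).2, (lt_min_iff.1 hτ.2).1, hτ.1⟩
      · rw [indicator_of_notMem hτ, indicator_of_notMem]
        exact fun h => hτ ⟨h.2.2.2, lt_min h.2.2.1 h.2.1⟩
    · rw [indicator_of_notMem hs, indicator_of_notMem]
      rintro ⟨h0, h1, h2, h3⟩
      exact hs ⟨by linarith, lt_of_mul_lt_mul_right (a := t) (by linarith) ht.1.le⟩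
  have hSg := hg.indicator hS
  calc _ = ∫⁻ τ, ∫⁻ s, S.indicator (Function.uncurry g) (τ, s) := by
        rw [← lintegral_indicator measurableSet_Ioo]
        refine lintegral_congr fun τ => ?_
        simp_rw [← h1]
        by_cases hτ : τ ∈ Ioo 0 t
        · simp only [indicator_of_mem hτ]
          rw [lintegral_indicator measurableSet_Ioo]
        · simp only [indicator_of_notMem hτ, lintegral_zero]
    _ = ∫⁻ s, ∫⁻ τ, S.indicator (Function.uncurry g) (τ, s) :=
        lintegral_lintegral_swap (f := fun τ s => S.indicator (Function.uncurry g) (τ, s))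
          hSg.aemeasurable
    _ = _ := by
        rw [← lintegral_indicator measurableSet_Ioo]
        refine lintegral_congr fun s => ?_
        simp_rw [← h2]
        by_cases hs : s ∈ Ioo (0 : ℝ) 1
        · simp only [indicator_of_mem hs]
          rw [lintegral_indicator measurableSet_Ioo]
        · simp only [indicator_of_notMem hs, lintegral_zero]

/-- The double integral as an average of a kernel which does not depend on `a`: the product
`w(τ) w(s t / τ)` involves `a` only through `(s t) ^ (a - 1)`. -/
lemma logSpread_eq {a b t : ℝ} (ht : t ∈ Ioo (0 : ℝ) 1) :
    logSpread a b t = ENNReal.ofReal (t * betaWeight a b t) *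
      ∫⁻ s in Ioo 0 1, ENNReal.ofReal (betaWeight a b s) * covKernel b s t := by
  have h3 := sub_pos.2 ht.2
  have htpos := ht.1
  have step : logSpread a b t = ∫⁻ τ in Ioo 0 t, ∫⁻ s in Ioo τ (τ / t),
      ENNReal.ofReal (t / τ) * ENNReal.ofReal ((Real.log (s * t / τ) - Real.log τ) *
        (betaWeight a b τ * betaWeight a b (s * t / τ))) :=
    setLIntegral_congr_fun measurableSet_Ioo fun τ hτ => setLIntegral_scale ht.1 hτ.1 _
  rw [step, lintegral_region_swap ht (by
    simp only [Function.uncurry_def]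
    fun_prop), ← lintegral_const_mul' _ _ ENNReal.ofReal_ne_top]
  refine setLIntegral_congr_fun measurableSet_Ioo fun s hs => ?_
  have h2 := sub_pos.2 hs.2
  have hspos := hs.1
  rw [covKernel_eq hs ht, ← lintegral_const_mul' _ _ ENNReal.ofReal_ne_top,
    ← lintegral_const_mul' _ _ ENNReal.ofReal_ne_top]
  refine setLIntegral_congr_fun measurableSet_Ioo fun τ hτ => ?_
  obtain ⟨h0, h1⟩ := lt_div_of_mem hs ht hτ
  have hwt := betaWeight_pos (a := a) (b := b) ht
  have hws := betaWeight_pos (a := a) (b := b) hs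
  rw [← ENNReal.ofReal_mul (by positivity), ← ENNReal.ofReal_mul (by positivity),
    ← ENNReal.ofReal_mul (by positivity)]
  congr 1
  have hτ1 : 0 < 1 - τ := by
    have := (lt_min_iff.1 hτ.2).1
    linarith
  have hσ1 : 0 < 1 - s * t / τ := sub_pos.2 ((div_lt_one h0).2 hτ.1)
  have hw : betaWeight a b τ * betaWeight a b (s * t / τ) =
      betaWeight a b t * betaWeight a b s * chordRatio s t τ ^ (b - 1) := by
    unfold betaWeight chordRatio
    rw [Real.div_rpow (mul_pos hτ1 hσ1).le (mul_pos h2 h3).le, Real.mul_rpow hτ1.le hσ1.le,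
      Real.mul_rpow h2.le h3.le, Real.div_rpow (by positivity) h0.le,
      Real.mul_rpow hspos.le htpos.le]
    have := (Real.rpow_pos_of_pos h2 (b - 1)).ne'
    have := (Real.rpow_pos_of_pos h3 (b - 1)).ne'
    have := (Real.rpow_pos_of_pos h0 (a - 1)).ne'
    field_simp
  rw [hw]
  ring

/-! ### Monotonicity of the kernel and of its mean -/

lemma covKernel_comm (b s t : ℝ) : covKernel b s t = covKernel b t s := by
  simp only [covKernel, mul_comm ((_ + s) / (1 - s))]

lemma covKernel_denom_pos {s t θ z : ℝ} (hs : s ∈ Ioo (0 : ℝ) 1) (ht : t ∈ Ioo (0 : ℝ) 1)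
    (hθ : θ ∈ Ioo (0 : ℝ) 1) (hz : 0 < z) :
    0 < (z + s) / (1 - s) * ((z + t) / (1 - t)) + (1 - θ) * z := by
  have h1 := sub_pos.2 hs.2
  have h2 := sub_pos.2 ht.2
  have h3 := sub_pos.2 hθ.2
  have h4 := hs.1
  have h5 := ht.1
  positivity

/-- A bound for the inner integral of the kernel, uniform in `θ`. -/
lemma exists_inner_covKernel_le {s t : ℝ} (hs : s ∈ Ioo (0 : ℝ) 1) (ht : t ∈ Ioo (0 : ℝ) 1) :
    ∃ C : ENNReal, C ≠ ⊤ ∧ ∀ θ ∈ Ioo (0 : ℝ) 1, ∫⁻ z in Ioi (0 : ℝ),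
      ENNReal.ofReal ((z + s) / (1 - s) * ((z + t) / (1 - t)) + (1 - θ) * z)⁻¹ ≤ C := by
  have hm : 0 < min s t := lt_min hs.1 ht.1
  have hms := min_le_left s t
  have hmt := min_le_right s t
  generalize min s t = m at *
  refine ⟨_, ENNReal.ofReal_ne_top, fun θ hθ => le_trans (setLIntegral_mono (by fun_prop)
    fun z hz => ENNReal.ofReal_le_ofReal ?_)
    (lintegral_inv_mul_eq_log (half_pos hm) (half_lt_self hm)).le⟩
  have hz : 0 < z := hz
  have h1 := sub_pos.2 hs.2
  have h2 := sub_pos.2 ht.2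
  have h3 := sub_pos.2 hθ.2
  have h4 := hs.1
  have h5 := ht.1
  gcongr
  have e1 : z + m ≤ (z + s) / (1 - s) := by
    rw [le_div_iff₀ h1]; nlinarith
  have e2 : z + m / 2 ≤ (z + t) / (1 - t) := by
    rw [le_div_iff₀ h2]; nlinarith
  have := mul_le_mul e1 e2 (by positivity) (by positivity)
  have : 0 < (1 - θ) * z := by positivity
  linarith

lemma lintegral_rpow_ne_top {b : ℝ} (hb : 0 < b) :
    ∫⁻ θ in Ioo (0 : ℝ) 1, ENNReal.ofReal (θ ^ (b - 1)) ≠ ⊤ := by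
  have h := (integrableOn_betaWeight hb one_pos).lintegral_lt_top
  simpa [betaWeight] using h.ne

lemma covKernel_ne_top {b s t : ℝ} (hb : 0 < b) (hs : s ∈ Ioo (0 : ℝ) 1)
    (ht : t ∈ Ioo (0 : ℝ) 1) : covKernel b s t ≠ ⊤ := by
  obtain ⟨C, hC, h⟩ := exists_inner_covKernel_le hs ht
  refine ne_top_of_le_ne_top ?_ (setLIntegral_mono (g := fun θ =>
    ENNReal.ofReal (θ ^ (b - 1)) * C) (by fun_prop) fun θ hθ => mul_le_mul_right (h θ hθ) _)
  rw [lintegral_mul_const _ (by fun_prop)]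
  exact ENNReal.mul_ne_top (lintegral_rpow_ne_top hb) hC

lemma covKernel_lt_covKernel {b s t t' : ℝ} (hb : 0 < b) (hs : s ∈ Ioo (0 : ℝ) 1)
    (ht : t ∈ Ioo (0 : ℝ) 1) (ht' : t' ∈ Ioo (0 : ℝ) 1) (htt' : t < t') :
    covKernel b s t' < covKernel b s t := by
  refine setLIntegral_strict_mono measurableSet_Ioo (by simp) ?_ (covKernel_ne_top hb hs ht')
    (Eventually.of_forall fun θ hθ => ?_)
  · fun_prop
  · obtain ⟨C, hC, h⟩ := exists_inner_covKernel_le hs ht'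
    refine ENNReal.mul_lt_mul_right (by simpa using Real.rpow_pos_of_pos hθ.1 _)
      ENNReal.ofReal_ne_top ?_
    refine setLIntegral_strict_mono measurableSet_Ioi (by simp) (by fun_prop)
      (ne_top_of_le_ne_top hC (h θ hθ)) (Eventually.of_forall fun z hz => ?_)
    have hz : 0 < z := hz
    have h0 := covKernel_denom_pos hs ht hθ hz
    rw [ENNReal.ofReal_lt_ofReal_iff (inv_pos.2 h0)]
    refine inv_strictAnti₀ h0 ?_
    have h1 := sub_pos.2 hs.2
    have h2 := sub_pos.2 ht'.2
    have h4 := hs.1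
    have h5 := ht.1
    have h6 := ht'.1
    gcongr

/-- The integral of `H (·, t)` against the unnormalised beta weight. -/
noncomputable def lintegralCovKernel (a b t : ℝ) : ENNReal :=
  ∫⁻ s in Ioo 0 1, ENNReal.ofReal (betaWeight a b s) * covKernel b s t

lemma measurable_covKernel_left (b t : ℝ) : Measurable fun s => covKernel b s t := by
  unfold covKernel
  fun_prop

/-- The double integral over a product set, multiplied out. -/
lemma logSpread_eq_ofReal {a b t : ℝ} (ha : 0 < a) (hb : 0 < b) (ht : t ∈ Ioo (0 : ℝ) 1) :
    logSpread a b t = ENNReal.ofReal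
      ((∫ x in Ioo 0 t, betaWeight a b x) * (∫ x in Ioo t 1, Real.log x * betaWeight a b x) -
        (∫ x in Ioo 0 t, Real.log x * betaWeight a b x) * ∫ x in Ioo t 1, betaWeight a b x) := by
  have hl : Ioo 0 t ⊆ Ioo 0 1 := Ioo_subset_Ioo_right ht.2.le
  have hr : Ioo t 1 ⊆ Ioo 0 1 := Ioo_subset_Ioo_left ht.1.le
  have A0 := (integrableOn_betaWeight ha hb).mono_set hl
  have A1 := (integrableOn_log_mul_betaWeight ha hb).mono_set hl
  have B0 := (integrableOn_betaWeight ha hb).mono_set hr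
  have B1 := (integrableOn_log_mul_betaWeight ha hb).mono_set hr
  have key : ∀ τ ∈ Ioo 0 t, ∫ σ in Ioo t 1,
      (Real.log σ - Real.log τ) * (betaWeight a b τ * betaWeight a b σ) =
      betaWeight a b τ * (∫ x in Ioo t 1, Real.log x * betaWeight a b x) -
        Real.log τ * betaWeight a b τ * ∫ x in Ioo t 1, betaWeight a b x := by
    intro τ _
    rw [← integral_const_mul, ← integral_const_mul, ← integral_sub (B1.const_mul _)
      (B0.const_mul _)]
    congr 1
    funext σ
    ring
  have nonneg : ∀ τ ∈ Ioo 0 t, ∀ σ ∈ Ioo t 1,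
      0 ≤ (Real.log σ - Real.log τ) * (betaWeight a b τ * betaWeight a b σ) := by
    intro τ hτ σ hσ
    have h1 := betaWeight_pos (a := a) (b := b) (hl hτ)
    have h2 := betaWeight_pos (a := a) (b := b) (hr hσ)
    have h3 := sub_nonneg.2 (Real.log_le_log hτ.1 (hτ.2.trans hσ.1).le)
    positivity
  have inner : ∀ τ ∈ Ioo 0 t, ∫⁻ σ in Ioo t 1, ENNReal.ofReal
      ((Real.log σ - Real.log τ) * (betaWeight a b τ * betaWeight a b σ)) = ENNReal.ofReal
      (betaWeight a b τ * (∫ x in Ioo t 1, Real.log x * betaWeight a b x) -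
        Real.log τ * betaWeight a b τ * ∫ x in Ioo t 1, betaWeight a b x) := by
    intro τ hτ
    rw [← key τ hτ, ofReal_integral_eq_lintegral_ofReal]
    · have := (B1.const_mul (betaWeight a b τ)).sub
        (B0.const_mul (Real.log τ * betaWeight a b τ))
      refine this.congr (Eventually.of_forall fun σ => ?_)
      simp only [Pi.sub_apply]
      ring
    · exact ae_restrict_of_forall_mem measurableSet_Ioo (nonneg τ hτ)
  have outer_nonneg : ∀ τ ∈ Ioo 0 t,
      0 ≤ betaWeight a b τ * (∫ x in Ioo t 1, Real.log x * betaWeight a b x) -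
        Real.log τ * betaWeight a b τ * ∫ x in Ioo t 1, betaWeight a b x := by
    intro τ hτ
    rw [← key τ hτ]
    exact setIntegral_nonneg measurableSet_Ioo (nonneg τ hτ)
  rw [logSpread, setLIntegral_congr_fun measurableSet_Ioo inner]
  clear key inner
  generalize (∫ x in Ioo t 1, Real.log x * betaWeight a b x) = X at *
  generalize (∫ x in Ioo t 1, betaWeight a b x) = Y at *
  rw [← integral_mul_const, ← integral_mul_const, ← integral_sub (A0.mul_const X) (A1.mul_const Y)]
  exact (ofReal_integral_eq_lintegral_ofReal ((A0.mul_const X).sub (A1.mul_const Y))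
    (ae_restrict_of_forall_mem measurableSet_Ioo outer_nonneg)).symm

lemma lintegralCovKernel_ne_top {a b t : ℝ} (ha : 0 < a) (hb : 0 < b) (ht : t ∈ Ioo (0 : ℝ) 1) :
    lintegralCovKernel a b t ≠ ⊤ := by
  intro h
  have h1 := logSpread_eq (a := a) (b := b) ht
  have : ENNReal.ofReal (t * betaWeight a b t) ≠ 0 := by
    simpa using mul_pos ht.1 (betaWeight_pos ht)
  rw [← lintegralCovKernel, h, ENNReal.mul_top this, logSpread_eq_ofReal ha hb ht] at h1
  exact ENNReal.ofReal_ne_top h1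

/-- The mean of `H (·, t)` under the beta distribution. At `t = q(a)` it is the slope of `log q`
at `a`. -/
noncomputable def meanCovKernel (a b t : ℝ) : ℝ :=
  (lintegralCovKernel a b t).toReal / ProbabilityTheory.beta a b

lemma lintegralCovKernel_lt {a b t t' : ℝ} (ha : 0 < a) (hb : 0 < b) (ht : t ∈ Ioo (0 : ℝ) 1)
    (ht' : t' ∈ Ioo (0 : ℝ) 1) (htt' : t < t') :
    lintegralCovKernel a b t' < lintegralCovKernel a b t := by
  have := measurable_covKernel_left b t
  refine setLIntegral_strict_mono measurableSet_Ioo (by simp) (by fun_prop)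
    (lintegralCovKernel_ne_top ha hb ht') (Eventually.of_forall fun s hs => ?_)
  exact ENNReal.mul_lt_mul_right (by simpa using betaWeight_pos hs) ENNReal.ofReal_ne_top
    (covKernel_lt_covKernel hb hs ht ht' htt')

lemma meanCovKernel_lt {a b t t' : ℝ} (ha : 0 < a) (hb : 0 < b) (ht : t ∈ Ioo (0 : ℝ) 1)
    (ht' : t' ∈ Ioo (0 : ℝ) 1) (htt' : t < t') : meanCovKernel a b t' < meanCovKernel a b t :=
  div_lt_div_of_pos_right (ENNReal.toReal_strict_mono (lintegralCovKernel_ne_top ha hb ht)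
    (lintegralCovKernel_lt ha hb ht ht' htt')) (ProbabilityTheory.beta_pos ha hb)

lemma meanCovKernel_pos {a b t : ℝ} (ha : 0 < a) (hb : 0 < b) (ht : t ∈ Ioo (0 : ℝ) 1) :
    0 < meanCovKernel a b t :=
  (div_nonneg ENNReal.toReal_nonneg (ProbabilityTheory.beta_pos ha hb).le).trans_lt
    (meanCovKernel_lt ha hb ht (t' := (t + 1) / 2) ⟨by linarith [ht.1], by linarith [ht.2]⟩
      (by linarith [ht.2]))

/-- The kernel representation of the covariance as an equation between real numbers. The left
side is recovered from its `ENNReal.ofReal` because the kernel mean is positive. -/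
lemma covariance_eq {a b t : ℝ} (ha : 0 < a) (hb : 0 < b) (ht : t ∈ Ioo (0 : ℝ) 1) :
    (∫ x in Ioo 0 t, betaWeight a b x) * (∫ x in Ioo t 1, Real.log x * betaWeight a b x) -
        (∫ x in Ioo 0 t, Real.log x * betaWeight a b x) * (∫ x in Ioo t 1, betaWeight a b x) =
      t * betaWeight a b t * (ProbabilityTheory.beta a b * meanCovKernel a b t) := by
  have hβ := ProbabilityTheory.beta_pos ha hb
  have hw : 0 < t * betaWeight a b t := mul_pos ht.1 (betaWeight_pos ht)
  have hE : ProbabilityTheory.beta a b * meanCovKernel a b t =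
      (lintegralCovKernel a b t).toReal := mul_div_cancel₀ _ hβ.ne'
  have hpos : 0 < (lintegralCovKernel a b t).toReal :=
    hE ▸ mul_pos hβ (meanCovKernel_pos ha hb ht)
  have h := logSpread_eq (a := a) (b := b) ht
  rw [logSpread_eq_ofReal ha hb ht, ← lintegralCovKernel,
    ← ENNReal.ofReal_toReal (lintegralCovKernel_ne_top ha hb ht), ← ENNReal.ofReal_mul hw.le] at h
  rw [hE]
  rcases le_total 0 ((∫ x in Ioo 0 t, betaWeight a b x) *
      (∫ x in Ioo t 1, Real.log x * betaWeight a b x) -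
      (∫ x in Ioo 0 t, Real.log x * betaWeight a b x) * ∫ x in Ioo t 1, betaWeight a b x) with h0 | h0
  · exact (ENNReal.ofReal_eq_ofReal_iff h0 (mul_pos hw hpos).le).1 h
  · rw [ENNReal.ofReal_of_nonpos h0] at h
    exact absurd (ENNReal.ofReal_eq_zero.1 h.symm) (mul_pos hw hpos).not_ge

lemma beta_lt_beta_left {a c b : ℝ} (ha : 0 < a) (hac : a < c) (hb : 0 < b) :
    ProbabilityTheory.beta c b < ProbabilityTheory.beta a b := by
  have h01 := intervalIntegrable_betaWeight ha hb (left_mem_Icc.2 zero_le_one)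
    (right_mem_Icc.2 zero_le_one)
  have h01' := intervalIntegrable_betaWeight (ha.trans hac) hb (left_mem_Icc.2 zero_le_one)
    (right_mem_Icc.2 zero_le_one)
  have : 0 < ∫ x in (0 : ℝ)..1, (betaWeight a b x - betaWeight c b x) := by
    refine intervalIntegral.intervalIntegral_pos_of_pos_on (h01.sub h01') (fun x hx => ?_)
      zero_lt_one
    rw [sub_pos]
    exact mul_lt_mul_of_pos_right
      (Real.rpow_lt_rpow_of_exponent_gt hx.1 hx.2 (by linarith))
      (Real.rpow_pos_of_pos (by linarith [hx.2]) _)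
  rw [intervalIntegral.integral_sub h01 h01', intervalIntegral.integral_of_le zero_le_one,
    intervalIntegral.integral_of_le zero_le_one, integral_Ioc_eq_integral_Ioo,
    integral_Ioc_eq_integral_Ioo, integral_betaWeight ha hb,
    integral_betaWeight (ha.trans hac) hb] at this
  linarith

/-- Chebyshev's correlation inequality: the mean of a decreasing function under the beta
distribution decreases with `a`. -/
lemma integral_mul_le_of_antitoneOn {a c b : ℝ} {r : ℝ → ℝ} (ha : 0 < a) (hac : a < c)
    (hb : 0 < b) (hr : AntitoneOn r (Ioo 0 1))
    (h1 : IntegrableOn (fun s => betaWeight a b s * r s) (Ioo 0 1))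
    (h2 : IntegrableOn (fun s => betaWeight c b s * r s) (Ioo 0 1)) :
    (∫ s in Ioo 0 1, betaWeight c b s * r s) / ProbabilityTheory.beta c b ≤
      (∫ s in Ioo 0 1, betaWeight a b s * r s) / ProbabilityTheory.beta a b := by
  have hc := ha.trans hac
  have w1 := integrableOn_betaWeight ha hb
  have w2 := integrableOn_betaWeight hc hb
  have Z1 := ProbabilityTheory.beta_pos ha hb
  have Z2 := ProbabilityTheory.beta_pos hc hb
  have hZ := beta_lt_beta_left ha hac hb
  -- `m` is the mean of `s ^ (c - a)` under the first distribution, and `s₀ ^ (c - a) = m`, so that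
  -- `s ^ (c - a) - m` and `r s - r s₀` have opposite signs
  set m := ProbabilityTheory.beta c b / ProbabilityTheory.beta a b with hm
  have hm0 : 0 < m := div_pos Z2 Z1
  have hm1 : m < 1 := (div_lt_one Z1).2 hZ
  have hd : 0 < c - a := by linarith
  have hs₀ : m ^ (c - a)⁻¹ ∈ Ioo (0 : ℝ) 1 :=
    ⟨Real.rpow_pos_of_pos hm0 _, Real.rpow_lt_one hm0.le hm1 (inv_pos.2 hd)⟩
  have hpow : (m ^ (c - a)⁻¹) ^ (c - a) = m := Real.rpow_inv_rpow hm0.le hd.ne'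
  generalize m ^ (c - a)⁻¹ = s₀ at *
  have hpt : ∀ s ∈ Ioo (0 : ℝ) 1, (betaWeight c b s * r s - m * (betaWeight a b s * r s)) -
      (r s₀ * betaWeight c b s - r s₀ * m * betaWeight a b s) ≤ 0 := by
    intro s hs
    have hw := betaWeight_pos (a := a) (b := b) hs
    have hcw : betaWeight c b s = s ^ (c - a) * betaWeight a b s := by
      unfold betaWeight
      rw [show c - 1 = (c - a) + (a - 1) by ring, Real.rpow_add hs.1]; ring
    have : (s ^ (c - a) - m) * (r s - r s₀) ≤ 0 := by
      rw [← hpow]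
      rcases le_total s s₀ with h | h
      · exact mul_nonpos_of_nonpos_of_nonneg
          (sub_nonpos.2 (Real.rpow_le_rpow hs.1.le h hd.le)) (sub_nonneg.2 (hr hs hs₀ h))
      · exact mul_nonpos_of_nonneg_of_nonpos
          (sub_nonneg.2 (Real.rpow_le_rpow hs₀.1.le h hd.le)) (sub_nonpos.2 (hr hs₀ hs h))
    rw [hcw]
    nlinarith [mul_nonneg hw.le (neg_nonneg.2 this)]
  have hint := setIntegral_nonpos (μ := volume) measurableSet_Ioo hpt
  have g1 : IntegrableOn (fun s => betaWeight c b s * r s - m * (betaWeight a b s * r s))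
      (Ioo 0 1) := h2.sub (h1.const_mul m)
  have g2 : IntegrableOn (fun s => r s₀ * betaWeight c b s - r s₀ * m * betaWeight a b s)
      (Ioo 0 1) := (w2.const_mul _).sub (w1.const_mul _)
  rw [integral_sub g1 g2, integral_sub h2 (h1.const_mul m),
    integral_sub (w2.const_mul _) (w1.const_mul _),
    integral_const_mul, integral_const_mul, integral_const_mul, integral_betaWeight ha hb,
    integral_betaWeight hc hb] at hint
  have hmZ : m * ProbabilityTheory.beta a b = ProbabilityTheory.beta c b := by
    rw [hm]; field_simp
  rw [mul_assoc, hmZ, sub_self, sub_zero, sub_nonpos] at hint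
  rw [div_le_div_iff₀ Z2 Z1, ← hmZ]
  nlinarith

lemma meanCovKernel_le {a c b t : ℝ} (ha : 0 < a) (hac : a < c) (hb : 0 < b)
    (ht : t ∈ Ioo (0 : ℝ) 1) : meanCovKernel c b t ≤ meanCovKernel a b t := by
  have hmeas := measurable_covKernel_left b t
  have e : ∀ d, ∀ s ∈ Ioo (0 : ℝ) 1, ENNReal.ofReal (betaWeight d b s) * covKernel b s t =
      ENNReal.ofReal (betaWeight d b s * (covKernel b s t).toReal) := by
    intro d s hs
    rw [ENNReal.ofReal_mul (betaWeight_pos hs).le, ENNReal.ofReal_toReal (covKernel_ne_top hb hs ht)]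
  have hE : ∀ d, lintegralCovKernel d b t = ∫⁻ s in Ioo (0 : ℝ) 1,
      ENNReal.ofReal (betaWeight d b s * (covKernel b s t).toReal) := fun d =>
    setLIntegral_congr_fun measurableSet_Ioo (e d)
  have nonneg : ∀ d, 0 ≤ᵐ[volume.restrict (Ioo (0 : ℝ) 1)]
      fun s => betaWeight d b s * (covKernel b s t).toReal := fun d =>
    ae_restrict_of_forall_mem measurableSet_Ioo fun s hs =>
      mul_nonneg (betaWeight_pos hs).le ENNReal.toReal_nonneg
  have hm : ∀ d, AEStronglyMeasurable (fun s => betaWeight d b s * (covKernel b s t).toReal)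
      (volume.restrict (Ioo (0 : ℝ) 1)) := fun d => by fun_prop
  have hi : ∀ d, 0 < d →
      IntegrableOn (fun s => betaWeight d b s * (covKernel b s t).toReal) (Ioo 0 1) := by
    intro d hd
    refine (lintegral_ofReal_ne_top_iff_integrable (hm d) (nonneg d)).1 ?_
    rw [← hE]
    exact lintegralCovKernel_ne_top hd hb ht
  have := integral_mul_le_of_antitoneOn ha hac hb (r := fun s => (covKernel b s t).toReal)
    (fun s hs s' hs' hss' => ?_) (hi a ha) (hi c (ha.trans hac))
  · rw [meanCovKernel, meanCovKernel, hE, hE]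
    rwa [integral_eq_lintegral_of_nonneg_ae (nonneg _) (hm _),
      integral_eq_lintegral_of_nonneg_ae (nonneg _) (hm _)] at this
  · refine ENNReal.toReal_mono (covKernel_ne_top hb hs ht) ?_
    rcases hss'.eq_or_lt with rfl | h
    · exact le_rfl
    · rw [covKernel_comm b s' t, covKernel_comm b s t]
      exact (covKernel_lt_covKernel hb ht hs hs' h).le

/-! ### Differentiation along a curve -/

/-- The contribution of a moving upper endpoint; the dependence of the integrand on the parameter
has no effect, the interval being empty at `x = a`. -/
lemma hasDerivAt_integral_moving_endpoint {f : ℝ → ℝ → ℝ} {u : ℝ → ℝ} {u' a : ℝ}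
    (hu : HasDerivAt u u' a) (hf : ContinuousAt (Function.uncurry f) (a, u a))
    (hint : ∀ᶠ x in 𝓝 a, IntervalIntegrable (f x) volume (u a) (u x)) :
    HasDerivAt (fun x => ∫ y in u a..u x, f x y) (u' * f a (u a)) a := by
  have hrem : HasDerivAt (fun x => (∫ y in u a..u x, f x y) - (u x - u a) * f a (u a)) 0 a := by
    rw [hasDerivAt_iff_isLittleO]
    simp only [intervalIntegral.integral_same, sub_self, zero_mul, smul_zero, sub_zero]
    refine Asymptotics.IsLittleO.trans_isBigO ?_ hu.isBigO_sub
    rw [Asymptotics.isLittleO_iff]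
    intro ε hε
    obtain ⟨δ, hδ, hball⟩ := Metric.continuousAt_iff.1 hf ε hε
    have hnear : ∀ᶠ x in 𝓝 a, dist (u x) (u a) < δ :=
      hu.continuousAt.eventually (Metric.ball_mem_nhds _ hδ)
    filter_upwards [hint, hnear, Metric.ball_mem_nhds a hδ] with x hx hux hxa
    have e : (∫ y in u a..u x, f x y) - (u x - u a) * f a (u a) =
        ∫ y in u a..u x, (f x y - f a (u a)) := by
      rw [intervalIntegral.integral_sub hx intervalIntegrable_const,
        intervalIntegral.integral_const, smul_eq_mul]
    rw [e]
    refine intervalIntegral.norm_integral_le_of_norm_le_const fun y hy => ?_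
    have hy' : dist y (u a) < δ := by
      refine lt_of_le_of_lt ?_ hux
      rw [Real.dist_eq, Real.dist_eq]
      exact abs_sub_left_of_mem_uIcc (uIoc_subset_uIcc hy)
    have := hball (x := (x, y)) (by rw [Prod.dist_eq]; exact max_lt hxa hy')
    rw [Real.dist_eq] at this
    exact this.le
  have := hrem.add ((hu.sub_const (u a)).mul_const (f a (u a)))
  rw [zero_add] at this
  refine this.congr_of_eventuallyEq (Eventually.of_forall fun x => ?_)
  simp

lemma setIntegral_Ioo_split {f : ℝ → ℝ} {t : ℝ} (hf : IntegrableOn f (Ioo 0 1))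
    (ht : t ∈ Ioo (0 : ℝ) 1) :
    ∫ x in Ioo 0 1, f x = (∫ x in Ioo 0 t, f x) + ∫ x in Ioo t 1, f x := by
  rw [← integrableOn_Ioc_iff_integrableOn_Ioo] at hf
  rw [← integral_Ioc_eq_integral_Ioo, ← integral_Ioc_eq_integral_Ioo,
    ← integral_Ioc_eq_integral_Ioo, ← Ioc_union_Ioc_eq_Ioc ht.1.le ht.2.le]
  exact setIntegral_union (Ioc_disjoint_Ioc_of_le le_rfl) measurableSet_Ioc
    (hf.mono_set (Ioc_subset_Ioc_right ht.2.le)) (hf.mono_set (Ioc_subset_Ioc_left ht.1.le))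

lemma continuousAt_betaWeight {a b t : ℝ} (ht : t ∈ Ioo (0 : ℝ) 1) :
    ContinuousAt (Function.uncurry fun a => betaWeight a b) (a, t) := by
  have h0 : t ≠ 0 := ht.1.ne'
  have h1 : 1 - t ≠ 0 := (sub_pos.2 ht.2).ne'
  refine ContinuousAt.mul ?_ ?_
  · exact ContinuousAt.rpow (by fun_prop) (by fun_prop) (Or.inl h0)
  · exact ContinuousAt.rpow (by fun_prop) (by fun_prop) (Or.inl h1)

lemma hasDerivAt_integral_betaWeight_comp {a b u' : ℝ} {u : ℝ → ℝ} (ha : 0 < a) (hb : 0 < b)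
    (hu : HasDerivAt u u' a) (hua : u a ∈ Ioo (0 : ℝ) 1) :
    HasDerivAt (fun x => ∫ y in Ioo 0 (u x), betaWeight x b y)
      ((∫ y in Ioo 0 (u a), Real.log y * betaWeight a b y) + u' * betaWeight a b (u a)) a := by
  have h1 := hasDerivAt_setIntegral_betaWeight ha hb (Ioo_subset_Ioo_right hua.2.le)
    measurableSet_Ioo
  have hnear : ∀ᶠ x in 𝓝 a, 0 < x ∧ u x ∈ Ioo (0 : ℝ) 1 :=
    (eventually_gt_nhds ha).and (hu.continuousAt.eventually (Ioo_mem_nhds hua.1 hua.2))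
  have h2 := hasDerivAt_integral_moving_endpoint (f := fun x => betaWeight x b) hu
    (continuousAt_betaWeight hua) (by
      filter_upwards [hnear] with x hx
      exact intervalIntegrable_betaWeight hx.1 hb (Ioo_subset_Icc_self hua)
        (Ioo_subset_Icc_self hx.2))
  refine (h1.add h2).congr_of_eventuallyEq ?_
  filter_upwards [hnear] with x hx
  have h0 : (0 : ℝ) ∈ Icc (0 : ℝ) 1 := left_mem_Icc.2 zero_le_one
  have := intervalIntegral.integral_add_adjacent_intervals
    (intervalIntegrable_betaWeight hx.1 hb h0 (Ioo_subset_Icc_self hua))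
    (intervalIntegrable_betaWeight hx.1 hb (Ioo_subset_Icc_self hua) (Ioo_subset_Icc_self hx.2))
  rw [intervalIntegral.integral_of_le hua.1.le, intervalIntegral.integral_of_le hx.2.1.le,
    integral_Ioc_eq_integral_Ioo, integral_Ioc_eq_integral_Ioo] at this
  exact this.symm

/-- Along a curve with logarithmic slope `s`, the regularised incomplete beta function moves with
the sign of `s - meanCovKernel`. -/
lemma hasDerivAt_regIncBeta_comp {a b s : ℝ} {u : ℝ → ℝ} (ha : 0 < a) (hb : 0 < b)
    (hu : HasDerivAt u (s * u a) a) (hua : u a ∈ Ioo (0 : ℝ) 1) :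
    HasDerivAt (fun x => regIncBeta (u x) x b)
      (u a * betaWeight a b (u a) * (s - meanCovKernel a b (u a)) / ProbabilityTheory.beta a b)
      a := by
  have hβ := ProbabilityTheory.beta_pos ha hb
  have hΦ := hasDerivAt_integral_betaWeight_comp ha hb hu hua
  have hZ := hasDerivAt_setIntegral_betaWeight ha hb subset_rfl measurableSet_Ioo
  have hZβ := integral_betaWeight ha hb
  have hq := hΦ.div hZ (by rw [hZβ]; exact hβ.ne')
  have hcov := covariance_eq ha hb hua
  have s0 := setIntegral_Ioo_split (integrableOn_betaWeight ha hb) hua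
  have s1 := setIntegral_Ioo_split (integrableOn_log_mul_betaWeight ha hb) hua
  refine (hq.congr_deriv ?_).congr_of_eventuallyEq ?_
  · rw [s1, hZβ]
    rw [hZβ] at s0
    rw [div_eq_div_iff (pow_pos hβ 2).ne' hβ.ne']
    generalize (∫ x in Ioo 0 (u a), betaWeight a b x) = A0 at *
    generalize (∫ x in Ioo 0 (u a), Real.log x * betaWeight a b x) = A1 at *
    generalize (∫ x in Ioo (u a) 1, betaWeight a b x) = B0 at *
    generalize (∫ x in Ioo (u a) 1, Real.log x * betaWeight a b x) = B1 at *
    generalize ProbabilityTheory.beta a b = Z at *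
    have : A1 * Z - A0 * (A1 + B1) =
        -(u a * betaWeight a b (u a) * (Z * meanCovKernel a b (u a))) := by
      rw [← hcov, s0]; ring
    linear_combination Z * this
  · filter_upwards [Ioi_mem_nhds ha, hu.continuousAt.eventually (Ioo_mem_nhds hua.1 hua.2)]
      with x hx hux
    rw [regIncBeta_eq hux.1.le, ← integral_betaWeight hx hb]
    rfl

/-! ### Strict concavity -/

/-- The tangent line of `log q` at `a₀` lies strictly above it elsewhere. -/
lemma log_invIncBeta_lt {a a₀ b p : ℝ} (ha : 0 < a) (ha₀ : 0 < a₀) (hb : 0 < b)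
    (hp : p ∈ Ioo (0 : ℝ) 1) (hne : a ≠ a₀) :
    Real.log (invIncBeta p a b) < Real.log (invIncBeta p a₀ b) +
      meanCovKernel a₀ b (invIncBeta p a₀ b) * (a - a₀) := by
  have hq := invIncBeta_mem ha hb hp
  have hq₀ := invIncBeta_mem ha₀ hb hp
  have hpq := regIncBeta_invIncBeta ha hb hp
  have hpq₀ := regIncBeta_invIncBeta ha₀ hb hp
  generalize invIncBeta p a b = q at *
  generalize invIncBeta p a₀ b = q₀ at *
  have hs := meanCovKernel_pos ha₀ hb hq₀
  set s := meanCovKernel a₀ b q₀ with hsdef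
  -- the exponential of the tangent line
  let u : ℝ → ℝ := fun x => q₀ * Real.exp (s * (x - a₀))
  have hu₀ : u a₀ = q₀ := by simp [u]
  have hupos : ∀ x, 0 < u x := fun x => mul_pos hq₀.1 (Real.exp_pos _)
  have hulog : ∀ x, Real.log (u x) = Real.log q₀ + s * (x - a₀) := fun x => by
    rw [Real.log_mul hq₀.1.ne' (Real.exp_pos _).ne', Real.log_exp]
  have humono : StrictMono u := fun x y hxy => by
    simp only [u]
    have := hq₀.1
    gcongr
  rw [← hulog]
  refine Real.log_lt_log hq.1 ?_
  rcases le_or_gt 1 (u a) with h1 | h1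
  · exact hq.2.trans_le h1
  -- between `a₀` and `a` the curve stays in the unit interval, as it is increasing
  have hderiv : ∀ x, HasDerivAt u (s * u x) x := fun x => by
    have := ((((hasDerivAt_id x).sub_const a₀).const_mul s).exp.const_mul q₀)
    refine this.congr_deriv ?_
    simp only [u, id]
    ring
  have hd : ∀ x, 0 < x → u x < 1 → HasDerivAt (fun x => regIncBeta (u x) x b)
      (u x * betaWeight x b (u x) * (s - meanCovKernel x b (u x)) / ProbabilityTheory.beta x b) x :=
    fun x hx hx1 => hasDerivAt_regIncBeta_comp hx hb (hderiv x) ⟨hupos x, hx1⟩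
  have hG : regIncBeta (u a₀) a₀ b < regIncBeta (u a) a b := by
    rcases hne.lt_or_gt with hlt | hgt
    · have hin : ∀ x ∈ Icc a a₀, 0 < x ∧ u x < 1 := fun x hx =>
        ⟨ha.trans_le hx.1, (humono.monotone hx.2).trans_lt (hu₀ ▸ hq₀.2)⟩
      refine strictAntiOn_of_deriv_neg (f := fun x => regIncBeta (u x) x b) (convex_Icc a a₀)
        (fun x hx => ?_) (fun x hx => ?_) (left_mem_Icc.2 hlt.le) (right_mem_Icc.2 hlt.le) hlt
      · obtain ⟨hx0, hx1⟩ := hin x hx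
        exact (hd x hx0 hx1).continuousAt.continuousWithinAt
      · rw [interior_Icc] at hx
        obtain ⟨hx0, hx1⟩ := hin x (Ioo_subset_Icc_self hx)
        rw [(hd x hx0 hx1).deriv]
        have hJ : s < meanCovKernel x b (u x) :=
          (meanCovKernel_le hx0 hx.2 hb hq₀).trans_lt
            (meanCovKernel_lt hx0 hb ⟨hupos x, hx1⟩ hq₀ (hu₀ ▸ humono hx.2))
        exact div_neg_of_neg_of_pos (mul_neg_of_pos_of_neg
          (mul_pos (hupos x) (betaWeight_pos ⟨hupos x, hx1⟩)) (sub_neg.2 hJ))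
          (ProbabilityTheory.beta_pos hx0 hb)
    · have hin : ∀ x ∈ Icc a₀ a, 0 < x ∧ u x < 1 := fun x hx =>
        ⟨ha₀.trans_le hx.1, (humono.monotone hx.2).trans_lt h1⟩
      refine strictMonoOn_of_deriv_pos (f := fun x => regIncBeta (u x) x b) (convex_Icc a₀ a)
        (fun x hx => ?_) (fun x hx => ?_) (left_mem_Icc.2 hgt.le) (right_mem_Icc.2 hgt.le) hgt
      · obtain ⟨hx0, hx1⟩ := hin x hx
        exact (hd x hx0 hx1).continuousAt.continuousWithinAt
      · rw [interior_Icc] at hx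
        obtain ⟨hx0, hx1⟩ := hin x (Ioo_subset_Icc_self hx)
        rw [(hd x hx0 hx1).deriv]
        have hJ : meanCovKernel x b (u x) < s :=
          (meanCovKernel_lt hx0 hb hq₀ ⟨hupos x, hx1⟩ (hu₀ ▸ humono hx.1)).trans_le
            (meanCovKernel_le ha₀ hx.1 hb hq₀)
        exact div_pos (mul_pos (mul_pos (hupos x) (betaWeight_pos ⟨hupos x, hx1⟩))
          (sub_pos.2 hJ)) (ProbabilityTheory.beta_pos hx0 hb)
  rw [hu₀, hpq₀, ← hpq] at hG
  exact ((strictMonoOn_regIncBeta ha hb).lt_iff_lt (Ioo_subset_Icc_self hq)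
    ⟨(hupos a).le, h1.le⟩).1 hG

lemma strictConcaveOn_of_lt_tangent {S : Set ℝ} (hS : Convex ℝ S) {f g : ℝ → ℝ}
    (h : ∀ x ∈ S, ∀ y ∈ S, x ≠ y → f x < f y + g y * (x - y)) : StrictConcaveOn ℝ S f := by
  refine ⟨hS, fun x hx y hy hxy α β hα hβ hαβ => ?_⟩
  have hm := hS hx hy hα.le hβ.le hαβ
  simp only [smul_eq_mul] at *
  obtain rfl : α = 1 - β := by linarith
  have h1 := h x hx _ hm (fun e => hxy (by
    have : β * (x - y) = 0 := by linear_combination e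
    rcases mul_eq_zero.1 this with h | h <;> linarith))
  have h2 := h y hy _ hm (fun e => hxy (by
    have : (1 - β) * (x - y) = 0 := by linear_combination -e
    rcases mul_eq_zero.1 this with h | h <;> linarith))
  generalize f ((1 - β) * x + β * y) = F at *
  generalize g ((1 - β) * x + β * y) = c at *
  linear_combination (1 - β) * h1 + β * h2

theorem theorem2 (p b : ℝ) (hp : p ∈ Ioo (0 : ℝ) 1) (hb : 0 < b) :
    (∀ a : ℝ, 0 < a →
      invIncBeta p a b ∈ Ioo (0 : ℝ) 1 ∧
      regIncBeta (invIncBeta p a b) a b = p ∧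
      ∀ x ∈ Ioo (0 : ℝ) 1, regIncBeta x a b = p → x = invIncBeta p a b) ∧
    StrictLogConcaveOn (Ioi 0) (fun a => invIncBeta p a b) ∧
    StrictConvexOn ℝ (Ioi 0) (fun a => -Real.log (invIncBeta p a b)) := by
  have hconc : StrictConcaveOn ℝ (Ioi 0) (fun a => Real.log (invIncBeta p a b)) :=
    strictConcaveOn_of_lt_tangent (convex_Ioi 0)
      (g := fun a => meanCovKernel a b (invIncBeta p a b))
      fun _ ha _ ha₀ hne => log_invIncBeta_lt ha ha₀ hb hp hne
  refine ⟨fun a ha => ⟨invIncBeta_mem ha hb hp, regIncBeta_invIncBeta ha hb hp,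
    fun x hx hxp => ?_⟩, ⟨fun a ha => (invIncBeta_mem ha hb hp).1, hconc⟩, hconc.neg⟩
  exact (strictMonoOn_regIncBeta ha hb).injOn (Ioo_subset_Icc_self hx)
    (Ioo_subset_Icc_self (invIncBeta_mem ha hb hp))
    (hxp.trans (regIncBeta_invIncBeta ha hb hp).symm)
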